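/- Let $\mathcal A$ be a von Neumann algebra (realised on a Hilbert space $\mathcal H$ as a $*$-subalgebra of $\mathcal B(\mathcal H)$ equal to its double commutant) and let $V(\mathcal A)$ be the poset, under inclusion, of its commutative von Neumann subalgebras (with the unit of $\mathcal A$). Let $\underline\Sigma\in\mathrm{Set}^{V(\mathcal A)^{op}}$ be the spectral presheaf: $\underline\Sigma(A)$ is the Gelfand spectrum of $A$ (characters, weak-$*$ topology), and for $A'\subset A$ the map $\underline\Sigma(A)\to\underline\Sigma(A')$ is restriction $\lambda\mapsto\lambda|_{A'}$. Let $\mathcal P\underline\Sigma$ be its power object, $\mathcal P\underline\Sigma(A)=\mathrm{Sub}(y_A\times\underline\Sigma)$, and let $\mathcal O\underline{\Sigma^*}\subset\mathcal P\underline\Sigma$ be the subpresheaf $$\mathcal O\underline{\Sigma^*}(A)=\{P\subset y_A\times\underline\Sigma \mid P(A')\text{ is open as a subset of }\underline\Sigma(A')\text{ for all }A'\in V(\mathcal A)\},$$ ordered by inclusion of subobjects. Let $\Sigma^*$ be the set of pairs $(A,\lambda)$ with $A\in V(\mathcal A)$, $\lambda\in\underline\Sigma(A)$, in which $U$ is open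 iff each $U_A=\{\lambda\mid(A,\lambda)\in U\}$ is open in $\underline\Sigma(A)$ and $\lambda\in U_A$, $A'\subset A$ imply $\lambda|_{A'}\in U_{A'}$; give $V(\mathcal A)$ the topology of lower sets, and let $\pi:\Sigma^*\to V(\mathcal A)$ be the (continuous) projection, the spectral bundle. Then: 1. $\mathcal O\underline{\Sigma^*}$, with the inclusion order, is an internal frame (equivalently, defines an internal locale) in $\mathrm{Set}^{V(\mathcal A)^{op}}$: it is an internal poset with internal finite meets, an internal join map $\bigvee:\mathcal P(\mathcal O\underline{\Sigma^*})\to\mathcal O\underline{\Sigma^*}$ defined on its power object, and it satisfies internally $a\wedge\bigvee S=\bigvee\{a\wedge s\mid s\in S\}$. 2. For every $A\in V(\mathcal A)$ there is an order isomorphism $\mathcal O\underline{\Sigma^*}(A)\cong\mathcal O(\pi^{-1}(\downarrow A))$ under which $P$ corresponds to $\{(A',\lambda)\mid A'\subset A,\ \lambda\in P(A')\}$. 3. The set of global sections of $\mathcal O\underline{\Sigma^*}$, ordered componentwise, is order isomorphic to the frame $\mathcal O(\Sigma^*)$ of open sets of the total space of the spectral bundle: a global section $(P_A)_A$ corresponds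 to the open set $U$ such that, for all $A'\subset A$, $(A',\lambda)\in U$ iff $\lambda\in P_A(A')$. -/

import Mathlib

open CategoryTheory Opposite TopologicalSpace WeakDual

universe u

namespace PresheafTopos

/-! ### Internal frames in a presheaf topos -/

section InternalFrames

variable {C : Type u} [SmallCategory C]

/-- The power object of a presheaf `F`, in its standard form: its value at `c` is the set
of subobjects of `y_c × F`, and it acts on morphisms by pullback. -/
def powerObject (F : Cᵒᵖ ⥤ Type u) : Cᵒᵖ ⥤ Type u where
  obj X := Subfunctor (FunctorToTypes.prod (yoneda.obj X.unop) F)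
  map {X Y} f := TypeCat.ofHom fun P =>
    { obj := fun Z => {p | ((p.1 ≫ f.unop, p.2) :
        (Z.unop ⟶ X.unop) × F.obj Z) ∈ P.obj Z}
      map := by
        intro U V i p hp
        have h := P.map i hp
        change ((i.unop ≫ p.1) ≫ f.unop, F.map i p.2) ∈ P.obj V
        rw [Category.assoc]
        exact h }
  map_id X := by
    ext P Z p
    change (p.1 ≫ 𝟙 X.unop, p.2) ∈ P.obj Z ↔ _
    rw [Category.comp_id]
    rfl
  map_comp {X Y W} f g := by
    ext P Z p
    change (p.1 ≫ (g.unop ≫ f.unop), p.2) ∈ P.obj Z ↔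
      ((p.1 ≫ g.unop) ≫ f.unop, p.2) ∈ P.obj Z
    rw [Category.assoc]

/-- The order on a subobject `G` of the power object of `F` given by inclusion of
subobjects of `y_c × F`, as a subobject of `G × G`. -/
def inclusionOrder {F : Cᵒᵖ ⥤ Type u} (G : Subfunctor (powerObject F)) :
    Subfunctor (FunctorToTypes.prod G.toFunctor G.toFunctor) where
  obj X := {p | ∀ Z, Subfunctor.obj p.1.1 Z ⊆ Subfunctor.obj p.2.1 Z}
  map := by
    intro X Y f p hp Z q hq
    exact hp Z hq

/-- An internal frame in the presheaf topos `Cᵒᵖ ⥤ Type u`: an internal poset with internal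
finite meets, with an internal join map defined on the power object,
and satisfying the infinite distributive law. -/
structure InternalFrame (L : Cᵒᵖ ⥤ Type u) where
  /-- the order, a subobject of `L × L` -/
  le : Subfunctor (FunctorToTypes.prod L L)
  le_refl : ∀ (X : Cᵒᵖ) (x : L.obj X), (x, x) ∈ le.obj X
  le_trans : ∀ (X : Cᵒᵖ) (x y z : L.obj X),
    (x, y) ∈ le.obj X → (y, z) ∈ le.obj X → (x, z) ∈ le.obj X
  le_antisymm : ∀ (X : Cᵒᵖ) (x y : L.obj X),
    (x, y) ∈ le.obj X → (y, x) ∈ le.obj X → x = y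
  /-- the top element, a global element of `L` -/
  top : L.sections
  le_top : ∀ (X : Cᵒᵖ) (x : L.obj X), (x, top.1 X) ∈ le.obj X
  /-- the binary meet -/
  inf : FunctorToTypes.prod L L ⟶ L
  le_inf_iff : ∀ (X : Cᵒᵖ) (x a b : L.obj X),
    (x, inf.app X (a, b)) ∈ le.obj X ↔ (x, a) ∈ le.obj X ∧ (x, b) ∈ le.obj X
  /-- the join of internal subsets of `L` -/
  sup : powerObject L ⟶ L
  /-- `⋁ S ≤ x` if and only if internally `y ≤ x` for all `y ∈ S`, that is,
  if and only if `S` is contained in the down-segment of `x` as a subobject of `y_c × L`. -/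
  sup_le_iff : ∀ (c : C) (S : Subfunctor (FunctorToTypes.prod (yoneda.obj c) L))
    (x : L.obj (op c)),
    (sup.app (op c) S, x) ∈ le.obj (op c) ↔
      ∀ (d : C) (f : d ⟶ c) (y : L.obj (op d)),
        (f, y) ∈ S.obj (op d) → (y, L.map f.op x) ∈ le.obj (op d)
  /-- `a ⊓ ⋁ S = ⋁ T` if internally `T = {a ⊓ s | s ∈ S}`. -/
  inf_sup : ∀ (c : C) (a : L.obj (op c))
    (S T : Subfunctor (FunctorToTypes.prod (yoneda.obj c) L)),
    (∀ (d : C) (f : d ⟶ c) (y : L.obj (op d)),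
      (f, y) ∈ T.obj (op d) ↔
        ∃ s : L.obj (op d), (f, s) ∈ S.obj (op d) ∧ y = inf.app (op d) (L.map f.op a, s)) →
    inf.app (op c) (a, sup.app (op c) S) = sup.app (op c) T

end InternalFrames

/-! ### Contexts and the spectral presheaf -/

section Spectral

variable {H : Type u} [NormedAddCommGroup H] [InnerProductSpace ℂ H] [CompleteSpace H]

/-- The commutative von Neumann subalgebras of `M`. -/
def Context (M : VonNeumannAlgebra H) : Type u :=
  {A : VonNeumannAlgebra H // A ≤ M ∧ ∀ x ∈ A, ∀ y ∈ A, x * y = y * x}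

/-- Contexts are ordered by inclusion. -/
instance (M : VonNeumannAlgebra H) : PartialOrder (Context M) :=
  inferInstanceAs (PartialOrder
    {A : VonNeumannAlgebra H // A ≤ M ∧ ∀ x ∈ A, ∀ y ∈ A, x * y = y * x})

/-- The anti-Alexandroff topology, whose open sets are the lower sets. -/
instance (M : VonNeumannAlgebra H) : TopologicalSpace (Context M) :=
  Topology.lowerSet (Context M)

/-- The underlying star algebra of a context. -/
abbrev Context.alg {M : VonNeumannAlgebra H} (A : Context M) : StarSubalgebra ℂ (H →L[ℂ] H) :=
  A.1.toStarSubalgebra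

instance {M : VonNeumannAlgebra H} (A : Context M) : CompleteSpace A.alg := by
  have h : IsClosed (A.alg : Set (H →L[ℂ] H)) := by
    have h1 : (A.alg : Set (H →L[ℂ] H)) = Set.centralizer (Set.centralizer (A.1 : Set _)) := by
      rw [VonNeumannAlgebra.centralizer_centralizer]
      rfl
    rw [h1]
    exact Set.isClosed_centralizer _
  exact h.completeSpace_coe

/-- The Gelfand spectrum of a context: the characters, with the weak-* topology. -/
abbrev Context.Spec {M : VonNeumannAlgebra H} (A : Context M) : Type u :=
  characterSpace ℂ A.alg

/-- Restriction of characters along an inclusion of contexts. -/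
noncomputable def Context.restrict {M : VonNeumannAlgebra H} {B A : Context M} (h : B ≤ A) :
    C(A.Spec, B.Spec) :=
  CharacterSpace.compContinuousMap
    (StarSubalgebra.inclusion (show B.alg ≤ A.alg from h))

/-- The spectral presheaf. -/
noncomputable def spectralPresheaf (M : VonNeumannAlgebra H) : (Context M)ᵒᵖ ⥤ Type u where
  obj X := X.unop.Spec
  map f := TypeCat.ofHom (Context.restrict (leOfHom f.unop))

/-- For a subobject `P` of `y_A × Σ`, the set `P(B)` regarded as a subset of `Σ(B)`. -/
def fiber {M : VonNeumannAlgebra H} {A : Context M}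
    (P : Subfunctor (FunctorToTypes.prod (yoneda.obj A) (spectralPresheaf M)))
    (B : Context M) : Set B.Spec :=
  {l | ∃ f : B ⟶ A, (f, l) ∈ P.obj (op B)}

/-- The presheaf of open subobjects of the spectral presheaf, as a subobject of the power object:
at `A` it consists of the subobjects of `y_A × Σ` that are open at every context. -/
def openSubobjects (M : VonNeumannAlgebra H) : Subfunctor (powerObject (spectralPresheaf M)) where
  obj X := {P | ∀ B : Context M, IsOpen (fiber (A := X.unop) P B)}
  map := by
    intro X Y f P hP B
    by_cases h : Nonempty (B ⟶ Y.unop)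
    · obtain ⟨g⟩ := h
      convert hP B using 1
      ext l
      constructor
      · rintro ⟨k, hk⟩
        exact ⟨k ≫ f.unop, hk⟩
      · rintro ⟨k, hk⟩
        refine ⟨g, ?_⟩
        have e : g ≫ f.unop = k := Subsingleton.elim _ _
        subst e
        exact hk
    · convert isOpen_empty (X := B.Spec) using 1
      ext l
      constructor
      · rintro ⟨k, -⟩
        exact (h ⟨k⟩).elim
      · exact fun hl => hl.elim

/-! ### The contravariant spectral bundle -/

/-- The points of the total space `Σ*` of the spectral bundle: pairs of a context and a
character of it. -/
@[ext]
structure BundleSpace (M : VonNeumannAlgebra H) : Type u where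
  ctx : Context M
  char : ctx.Spec

/-- A set is open in `Σ*` if its fibres are open and it is closed under restriction. -/
instance (M : VonNeumannAlgebra H) : TopologicalSpace (BundleSpace M) where
  IsOpen U := (∀ A : Context M, IsOpen {l : A.Spec | (⟨A, l⟩ : BundleSpace M) ∈ U}) ∧
    ∀ (A : Context M) (l : A.Spec), (⟨A, l⟩ : BundleSpace M) ∈ U →
      ∀ (B : Context M) (h : B ≤ A), (⟨B, Context.restrict h l⟩ : BundleSpace M) ∈ U
  isOpen_univ := ⟨fun _ => isOpen_univ, fun _ _ _ _ _ => trivial⟩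
  isOpen_inter U V hU hV :=
    ⟨fun A => (hU.1 A).inter (hV.1 A),
      fun A l hl B h => ⟨hU.2 A l hl.1 B h, hV.2 A l hl.2 B h⟩⟩
  isOpen_sUnion S hS := by
    refine ⟨fun A => ?_, ?_⟩
    · have h : {l : A.Spec | (⟨A, l⟩ : BundleSpace M) ∈ ⋃₀ S} =
          ⋃ U ∈ S, {l : A.Spec | (⟨A, l⟩ : BundleSpace M) ∈ U} := by
        ext l
        simp
      rw [h]
      exact isOpen_biUnion fun U hU => (hS U hU).1 A
    · rintro A l ⟨U, hU, hl⟩ B h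
      exact ⟨U, hU, (hS U hU).2 A l hl B h⟩

/-- The spectral bundle `π : Σ* → V(M)`. -/
def spectralBundle (M : VonNeumannAlgebra H) : C(BundleSpace M, Context M) where
  toFun x := x.ctx
  continuous_toFun := by
    refine ⟨fun W hW => ?_⟩
    have hW' : IsLowerSet W := hW
    refine ⟨fun A => ?_, fun A l hl B h => hW' h hl⟩
    by_cases hA : A ∈ W
    · convert isOpen_univ (X := A.Spec) using 1
      ext l
      exact iff_of_true hA trivial
    · convert isOpen_empty (X := A.Spec) using 1
      ext l
      exact iff_of_false hA id

end Spectral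

end PresheafTopos

open PresheafTopos

namespace PresheafTopos

variable {H : Type u} [NormedAddCommGroup H] [InnerProductSpace ℂ H] [CompleteSpace H]

/-! Contexts form a poset, so a morphism `B ⟶ A` carries no information beyond `B ≤ A`. An open
subobject of `y_A × Σ` is therefore just a family of open sets of characters, one for each `B ≤ A`,
stable under restriction; `part` and `ofFamily` pass between the two descriptions. Order, meets and
joins are computed fibrewise by inclusions, intersections and unions, and pullback only discards the
fibres outside a smaller down-set. The frame law thus reduces to distributivity of intersection over
unions of sets.

The same families describe the opens of the bundle over `↓A`. For global sections, `part_section`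
shows that the diagonal fibres `P_B(B)` determine everything, and they form an open set of the total
space. -/

/-- The open subobjects of `y_A × Σ`. -/
abbrev OpenSubobject {M : VonNeumannAlgebra H} (A : Context M) : Type u :=
  (openSubobjects M).toFunctor.obj (op A)

namespace OpenSubobject

variable {M : VonNeumannAlgebra H} {A B D : Context M}

/-- The part of an open subobject of `y_A × Σ` over a context contained in `A`. -/
noncomputable def part (P : OpenSubobject A) (h : B ≤ A) : Set B.Spec :=
  {l | ((homOfLE h, l) : (B ⟶ A) × B.Spec) ∈ Subfunctor.obj P.1 (op B)}

theorem isOpen_part (P : OpenSubobject A) (h : B ≤ A) : IsOpen (P.part h) := by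
  convert P.2 B using 1
  ext l
  exact ⟨fun hl => ⟨homOfLE h, hl⟩, fun ⟨_, hl⟩ => hl⟩

theorem restrict_mem_part (P : OpenSubobject A) (h : B ≤ A) (k : D ≤ B) {l : B.Spec}
    (hl : l ∈ P.part h) : Context.restrict k l ∈ P.part (k.trans h) :=
  Subfunctor.map P.1 (homOfLE k).op hl

@[ext]
theorem ext {P Q : OpenSubobject A}
    (h : ∀ (B : Context M) (hB : B ≤ A), P.part hB = Q.part hB) : P = Q := by
  apply Subtype.ext
  apply Subfunctor.ext
  funext Z
  ext p
  exact Set.ext_iff.1 (h Z.unop (leOfHom p.1)) p.2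

theorem le_iff {P Q : OpenSubobject A} :
    (P, Q) ∈ (inclusionOrder (openSubobjects M)).obj (op A) ↔
      ∀ (B : Context M) (h : B ≤ A), P.part h ⊆ Q.part h :=
  ⟨fun hPQ B _ _ hl => hPQ (op B) hl, fun hPQ Z p hp => hPQ Z.unop (leOfHom p.1) hp⟩

/-- A family of open sets stable under restriction is an open subobject. -/
noncomputable def ofFamily (S : ∀ B : Context M, B ≤ A → Set B.Spec) (hS : ∀ B h, IsOpen (S B h))
    (hres : ∀ (B D : Context M) (h : B ≤ A) (k : D ≤ B) (l : B.Spec),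
      l ∈ S B h → Context.restrict k l ∈ S D (k.trans h)) : OpenSubobject A :=
  ⟨{ obj := fun Z => {p | p.2 ∈ S Z.unop (leOfHom p.1)}
     map := fun {X Y} f p hp => hres X.unop Y.unop (leOfHom p.1) (leOfHom f.unop) p.2 hp },
   fun B => by
    by_cases h : B ≤ A
    · convert hS B h using 1
      ext l
      exact ⟨fun ⟨_, hl⟩ => hl, fun hl => ⟨homOfLE h, hl⟩⟩
    · convert isOpen_empty (X := B.Spec) using 1
      ext l
      exact ⟨fun ⟨k, _⟩ => h (leOfHom k), fun hl => hl.elim⟩⟩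

@[simp]
theorem part_ofFamily (S : ∀ B : Context M, B ≤ A → Set B.Spec) (hS hres) (h : B ≤ A) :
    (ofFamily S hS hres).part h = S B h :=
  rfl

/-- Pullback of open subobjects along an inclusion of contexts. -/
noncomputable abbrev pullback (f : B ⟶ A) (P : OpenSubobject A) : OpenSubobject B :=
  (openSubobjects M).toFunctor.map f.op P

/-- The top open subobject. -/
noncomputable def top (A : Context M) : OpenSubobject A :=
  ofFamily (fun _ _ => Set.univ) (fun _ _ => isOpen_univ) fun _ _ _ _ _ _ => trivial

/-- The intersection of two open subobjects. -/
noncomputable def inf (P Q : OpenSubobject A) : OpenSubobject A :=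
  ofFamily (fun _ h => P.part h ∩ Q.part h) (fun _ h => (P.isOpen_part h).inter (Q.isOpen_part h))
    fun _ _ h k _ hl => ⟨P.restrict_mem_part h k hl.1, Q.restrict_mem_part h k hl.2⟩

/-- The internal join of a subobject of `y_A × L`, where `L` is the presheaf of open subobjects:
over `B` it is the union of the fibres over `B` of the members at stage `B`. -/
noncomputable def sup (S : Subfunctor (FunctorToTypes.prod (yoneda.obj A) (openSubobjects M).toFunctor)) :
    OpenSubobject A :=
  ofFamily
    -- Members of `S` at stages between `B` and `A` need no separate mention: `S` is closed under
    -- pullback, so their restrictions occur at stage `B` with the same fibre over `B`.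
    (fun B h => ⋃ y ∈ {y : OpenSubobject B |
      ((homOfLE h, y) : (B ⟶ A) × OpenSubobject B) ∈ S.obj (op B)}, y.part le_rfl)
    (fun _ _ => isOpen_biUnion fun y _ => y.isOpen_part le_rfl)
    (by
      intro B D h k l hl
      simp only [Set.mem_iUnion] at hl ⊢
      obtain ⟨y, hy, hl⟩ := hl
      exact ⟨pullback (homOfLE k) y, S.map (homOfLE k).op hy, y.restrict_mem_part le_rfl k hl⟩)

theorem mem_part_sup
    {S : Subfunctor (FunctorToTypes.prod (yoneda.obj A) (openSubobjects M).toFunctor)}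
    {h : B ≤ A} {l : B.Spec} :
    l ∈ (sup S).part h ↔ ∃ y : OpenSubobject B,
      ((homOfLE h, y) : (B ⟶ A) × OpenSubobject B) ∈ S.obj (op B) ∧ l ∈ y.part le_rfl := by
  simp [sup]

end OpenSubobject

open OpenSubobject

/-- The internal frame of open subobjects of the spectral presheaf. -/
noncomputable def openSubobjectsFrame (M : VonNeumannAlgebra H) :
    InternalFrame (openSubobjects M).toFunctor where
  le := inclusionOrder (openSubobjects M)
  le_refl _ _ _ _ hp := hp
  le_trans _ _ _ _ h k Z _ hp := k Z (h Z hp)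
  le_antisymm _ _ _ h k := OpenSubobject.ext fun B hB =>
    Set.Subset.antisymm (le_iff.1 h B hB) (le_iff.1 k B hB)
  top := ⟨fun X => OpenSubobject.top X.unop, fun _ => rfl⟩
  le_top _ _ := le_iff.2 fun _ _ _ _ => trivial
  inf :=
    { app := fun X => TypeCat.ofHom fun p => OpenSubobject.inf (A := X.unop) p.1 p.2
      naturality := fun _ _ _ => rfl }
  le_inf_iff _ _ _ _ :=
    ⟨fun h => ⟨le_iff.2 fun B hB _ hl => (le_iff.1 h B hB hl).1,
      le_iff.2 fun B hB _ hl => (le_iff.1 h B hB hl).2⟩,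
     fun h => le_iff.2 fun B hB _ hl => ⟨le_iff.1 h.1 B hB hl, le_iff.1 h.2 B hB hl⟩⟩
  sup :=
    { app := fun X => TypeCat.ofHom fun S => OpenSubobject.sup (A := X.unop) S
      naturality := fun _ _ _ => rfl }
  sup_le_iff A S x := by
    constructor
    · intro h B f y hy
      refine le_iff.2 fun D hD l hl => ?_
      -- The fibre of `y` over `D` is the diagonal fibre of its pullback to `D`, which again belongs
      -- to `S`.
      exact le_iff.1 h D (hD.trans (leOfHom f))
        (mem_part_sup.2 ⟨pullback (homOfLE hD) y, S.map (homOfLE hD).op hy, hl⟩)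
    · intro h
      refine le_iff.2 fun B hB l hl => ?_
      obtain ⟨y, hy, hl⟩ := mem_part_sup.1 hl
      exact le_iff.1 (h B (homOfLE hB) y hy) B le_rfl hl
  inf_sup A a S T hT := by
    refine OpenSubobject.ext fun B hB => Set.ext fun l => ?_
    constructor
    · rintro ⟨ha, hS⟩
      obtain ⟨s, hs, hl⟩ := mem_part_sup.1 hS
      -- The member of `T` is the meet of `s` with `a` pulled back to `B`; that pullback has the
      -- same fibre over `B` as `a`.
      exact mem_part_sup.2 ⟨_, (hT B (homOfLE hB) _).2 ⟨s, hs, rfl⟩, ha, hl⟩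
    · intro hl
      obtain ⟨t, ht, hl⟩ := mem_part_sup.1 hl
      obtain ⟨s, hs, rfl⟩ := (hT B (homOfLE hB) t).1 ht
      exact ⟨hl.1, mem_part_sup.2 ⟨s, hs, hl.2⟩⟩

variable {M : VonNeumannAlgebra H}

/-- The open subobjects of `y_A × Σ` are the opens of the spectral bundle over `↓A`. -/
noncomputable def openSubobjectEquivOpens (A : Context M) :
    OpenSubobject A ≃ Opens (spectralBundle M ⁻¹' Set.Iic A) where
  toFun P := ⟨{x | x.1.char ∈ P.part x.2}, by
    -- Extended by empty fibres outside `↓A`, the family stays stable under restriction because `↓A`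
    -- is a lower set.
    refine ⟨{x | ∃ h : x.ctx ≤ A, x.char ∈ P.part h}, ⟨fun B => ?_, ?_⟩, ?_⟩
    · by_cases h : B ≤ A
      · convert P.isOpen_part h using 1
        ext l
        exact ⟨fun ⟨_, hl⟩ => hl, fun hl => ⟨h, hl⟩⟩
      · simp [h]
    · rintro B l ⟨h, hl⟩ D k
      exact ⟨k.trans h, P.restrict_mem_part h k hl⟩
    · ext x
      exact ⟨fun ⟨_, hl⟩ => hl, fun hl => ⟨x.2, hl⟩⟩⟩
  invFun U := ofFamily (fun B h => {l | (⟨⟨B, l⟩, h⟩ : spectralBundle M ⁻¹' Set.Iic A) ∈ U})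
    (fun B h => by
      obtain ⟨V, hV, hVU⟩ := U.2
      convert hV.1 B using 1
      ext l
      exact (Set.ext_iff.1 hVU ⟨⟨B, l⟩, h⟩).symm)
    (fun B D h k l hl => by
      -- Stability is inherited from an ambient open `V` that agrees with `U` over `↓A`, where both
      -- `B` and `D` lie.
      obtain ⟨V, hV, hVU⟩ := U.2
      exact (Set.ext_iff.1 hVU ⟨⟨D, _⟩, k.trans h⟩).1
        (hV.2 B l ((Set.ext_iff.1 hVU ⟨⟨B, l⟩, h⟩).2 hl) D k))
  left_inv _ := rfl
  right_inv _ := rfl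

theorem openSubobjectEquivOpens_le_iff {A : Context M} {P Q : OpenSubobject A} :
    openSubobjectEquivOpens A P ≤ openSubobjectEquivOpens A Q ↔
      (P, Q) ∈ (inclusionOrder (openSubobjects M)).obj (op A) := by
  rw [le_iff]
  exact ⟨fun h B hB l hl => @h ⟨⟨B, l⟩, hB⟩ hl, fun h x hx => h x.1.ctx x.2 hx⟩

/-- Compatibility of a section along `B ≤ A` makes `P_B` the pullback of `P_A`, and pullback keeps
the fibre over `B`. -/
theorem part_section (s : (openSubobjects M).toFunctor.sections) {A B : Context M} (h : B ≤ A) :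
    OpenSubobject.part (s.1 (op A)) h = OpenSubobject.part (s.1 (op B)) le_rfl := by
  rw [← s.2 (homOfLE h).op]
  rfl

/-- The global sections of the presheaf of open subobjects are the opens of the total space of
the spectral bundle. -/
noncomputable def sectionsEquivOpens (M : VonNeumannAlgebra H) :
    (openSubobjects M).toFunctor.sections ≃ Opens (BundleSpace M) where
  toFun s := ⟨{x | x.char ∈ OpenSubobject.part (s.1 (op x.ctx)) le_rfl},
    fun A => OpenSubobject.isOpen_part (s.1 (op A)) le_rfl, fun A l hl B h => by
      have := OpenSubobject.restrict_mem_part (s.1 (op A)) le_rfl h hl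
      rwa [part_section] at this⟩
  invFun U := ⟨fun _ => ofFamily (fun B _ => {l | (⟨B, l⟩ : BundleSpace M) ∈ U})
    (fun B _ => U.2.1 B) (fun B D _ k l hl => U.2.2 B l hl D k), fun _ => rfl⟩
  left_inv s := by
    apply Subtype.ext
    funext X
    exact OpenSubobject.ext fun B hB => (part_section s (A := X.unop) hB).symm
  right_inv _ := rfl

theorem mem_sectionsEquivOpens (s : (openSubobjects M).toFunctor.sections) {A B : Context M}
    (h : B ≤ A) (l : B.Spec) :
    (⟨B, l⟩ : BundleSpace M) ∈ sectionsEquivOpens M s ↔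
      l ∈ OpenSubobject.part (s.1 (op A)) h := by
  rw [part_section]
  rfl

theorem sectionsEquivOpens_le_iff {s t : (openSubobjects M).toFunctor.sections} :
    sectionsEquivOpens M s ≤ sectionsEquivOpens M t ↔
      ∀ A : Context M, (s.1 (op A), t.1 (op A)) ∈
        (inclusionOrder (openSubobjects M)).obj (op A) := by
  constructor
  · exact fun h A => le_iff.2 fun B hB l hl =>
      (mem_sectionsEquivOpens t hB l).1 (h ((mem_sectionsEquivOpens s hB l).2 hl))
  · exact fun h x hx => le_iff.1 (h x.ctx) x.ctx le_rfl hx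

end PresheafTopos


theorem mainTheorem8 {H : Type u} [NormedAddCommGroup H] [InnerProductSpace ℂ H]
    [CompleteSpace H] (M : VonNeumannAlgebra H) :
    -- the open subobjects form an internal frame under inclusion
    (∃ L : InternalFrame (openSubobjects M).toFunctor,
      L.le = inclusionOrder (openSubobjects M)) ∧
    -- at each context they are the opens of the bundle over the corresponding principal lower set
    (∀ A : Context M,
      ∃ e : (openSubobjects M).toFunctor.obj (op A) ≃ Opens (spectralBundle M ⁻¹' Set.Iic A),
        (∀ P (x : spectralBundle M ⁻¹' Set.Iic A),
          x ∈ e P ↔ ((homOfLE x.2, x.1.char) : (x.1.ctx ⟶ A) × x.1.ctx.Spec) ∈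
            Subfunctor.obj P.1 (op x.1.ctx)) ∧
        ∀ P Q, e P ≤ e Q ↔ (P, Q) ∈ (inclusionOrder (openSubobjects M)).obj (op A)) ∧
    -- the global opens are the opens of the total space
    (∃ e : (openSubobjects M).toFunctor.sections ≃ Opens (BundleSpace M),
      (∀ s (A B : Context M) (h : B ≤ A) (l : B.Spec),
        (⟨B, l⟩ : BundleSpace M) ∈ e s ↔ ((homOfLE h, l) : (B ⟶ A) × B.Spec) ∈
          Subfunctor.obj (s.1 (op A)).1 (op B)) ∧
      ∀ s t, e s ≤ e t ↔
        ∀ A : Context M, (s.1 (op A), t.1 (op A)) ∈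
          (inclusionOrder (openSubobjects M)).obj (op A)) :=
  ⟨⟨openSubobjectsFrame M, rfl⟩,
    fun A => ⟨openSubobjectEquivOpens A, fun _ _ => Iff.rfl,
      fun _ _ => openSubobjectEquivOpens_le_iff⟩,
    sectionsEquivOpens M, fun s _ _ h l => mem_sectionsEquivOpens s h l,
    fun _ _ => sectionsEquivOpens_le_iff⟩
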